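/- Let $(S_n)_{n\ge 0}$ be a one-dimensional simple symmetric random walk on $\mathbb{Z}$ with $S_0=0$. For $x\in\mathbb{Z}$ and $n\ge 1$ let $$\xi_D(x,n)=\#\{0<k\le n: S_k=x,\ S_{k-1}=x+1\}$$ be the number of downcrossings of the site $x$ by time $n$, and let $$\mathcal{K}_D(n)=\Big\{x\in\mathbb{Z}: \xi_D(x,n)=\max_{y\in\mathbb{Z}}\xi_D(y,n)\Big\}$$ be the set of favorite downcrossing sites at time $n$. For $r\ge 1$ let $$f(r)=\#\{n\ge 1: S_n\in\mathcal{K}_D(n),\ S_n=S_{n-1}-1,\ \#\mathcal{K}_D(n)=r\}\in\{0,1,2,\dots\}\cup\{\infty\}.$$ Then $\mathbb{E}(f(4))<+\infty$. -/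

import Mathlib

open MeasureTheory ProbabilityTheory
open scoped ENNReal

/-- `S` is a one-dimensional simple symmetric random walk started at `0` on the probability
space `(Ω, μ)`: its increments are independent and equal to `1` or `-1` with probability `1/2`
each. -/
structure IsSimpleSymmetricRandomWalk {Ω : Type*} [MeasurableSpace Ω] (μ : Measure Ω)
    (S : ℕ → Ω → ℤ) : Prop where
  measurable : ∀ n, Measurable (S n)
  start : ∀ᵐ ω ∂μ, S 0 ω = 0
  indep : iIndepFun (fun (n : ℕ) (ω : Ω) => S (n + 1) ω - S n ω) μ
  up : ∀ n, μ {ω | S (n + 1) ω - S n ω = 1} = 1 / 2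
  down : ∀ n, μ {ω | S (n + 1) ω - S n ω = -1} = 1 / 2

/-- The downcrossing local time `ξ_D(x, n) = #{0 < k ≤ n : s k = x, s (k - 1) = x + 1}` of the
site `x` by time `n`, for a trajectory `s`. -/
def downcrossings (s : ℕ → ℤ) (x : ℤ) (n : ℕ) : ℕ :=
  ((Finset.Ioc 0 n).filter (fun k => s k = x ∧ s (k - 1) = x + 1)).card

/-- The set `K_D(n)` of favorite downcrossing sites at time `n`: the sites whose downcrossing
local time is maximal among all sites. -/
def favoriteDowncrossingSites (s : ℕ → ℤ) (n : ℕ) : Set ℤ :=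
  {x | ∀ y : ℤ, downcrossings s y n ≤ downcrossings s x n}

/-- `f(r)`: the number (possibly infinite) of times `n ≥ 1` at which the trajectory makes a
down-step to a favorite downcrossing site while there are exactly `r` favorite downcrossing
sites. -/
noncomputable def favoriteDowncrossingCount (s : ℕ → ℤ) (r : ℕ) : ℕ∞ :=
  {n : ℕ | 1 ≤ n ∧ s n ∈ favoriteDowncrossingSites s n ∧ s n = s (n - 1) - 1 ∧
    (favoriteDowncrossingSites s n).encard = (r : ℕ∞)}.encard

/-! Fix a height `h`. A down-step that completes a favorite set of four sites at height `h` is the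
event `TieLevel h 0 K`. For each `j`, `TieLevel h j K` occurs at most once along a trajectory, so by
Kraft's inequality (`tsum_avg_le_one`) its probabilities, summed over all times, give at most 1.

A surgery improves this trivial bound. Inserting a loop y → y + 1 → y at a visit to a tied site y
other than the endpoint raises y by one and changes neither the endpoint nor the height of any other
site. Two extra steps cost a factor 4 in probability, but only about a quarter of the visits to y
start such a loop; counting marked visits against marked loops (`avg_visits_le_avg_loops`) shows
that an insertion nearly preserves probability. Up to K insertions cost a bounded factor and place y
at any of K different heights. Hence, up to a large-deviation error, the weight of `TieLevel h j K`
is O(1/K) times that of `TieLevel h (j + 1) K` (`mul_tsum_avg_tieLevel_le`).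

Four tied sites leave three besides the endpoint, so height `h` contributes O(K⁻³). Controlling the
fluctuations of the loop count requires K ≪ h^(1/2), and summability over `h` requires K ≫ h^(1/3).
The choice K ≈ h^(2/5) gives the convergent series ∑ h^(-6/5). -/

namespace SignPath

/-! ### Combinatorics of finite ±1 paths -/

/-- The increment coded by a bit: `true` is an up-step, `false` a down-step. -/
def step (b : Bool) : ℤ := if b then 1 else -1

@[simp] lemma step_true : step true = 1 := rfl

@[simp] lemma step_false : step false = -1 := rfl

/-- The total displacement of a finite path. -/
def disp : List Bool → ℤ
  | [] => 0
  | c :: l => step c + disp l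

@[simp] lemma disp_nil : disp [] = 0 := rfl

@[simp] lemma disp_cons (c : Bool) (l : List Bool) : disp (c :: l) = step c + disp l := rfl

@[simp] lemma disp_append (a b : List Bool) : disp (a ++ b) = disp a + disp b := by
  induction a with
  | nil => simp
  | cons c a ih => simp [ih, add_assoc]

/-- The number of down-steps into `y` of a finite path started at `p`. -/
def downs (y : ℤ) : ℤ → List Bool → ℕ
  | _, [] => 0
  | p, c :: l => (if p = y + 1 ∧ c = false then 1 else 0) + downs y (p + step c) l

/-- The number of visits to `y` (both ends included) of a finite path started at `p`. -/
def visits (y : ℤ) : ℤ → List Bool → ℕ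
  | p, [] => if p = y then 1 else 0
  | p, c :: l => (if p = y then 1 else 0) + visits y (p + step c) l

/-- The number of immediate loops `y → y + 1 → y` of a finite path started at `p`. -/
def loops (y : ℤ) : ℤ → List Bool → ℕ
  | _, [] => 0
  | p, c :: l =>
    (if p = y ∧ c = true ∧ l.head? = some false then 1 else 0) + loops y (p + step c) l

lemma downs_append (y p : ℤ) (a b : List Bool) :
    downs y p (a ++ b) = downs y p a + downs y (p + disp a) b := by
  induction a generalizing p with
  | nil => simp [downs]
  | cons c a ih => simp [downs, ih, add_assoc]

lemma downs_insert_loop (y y' p : ℤ) (a b : List Bool) (h : p + disp a = y) :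
    downs y' p (a ++ true :: false :: b) = downs y' p (a ++ b) + if y' = y then 1 else 0 := by
  have e : (y + 1 = y' + 1) ↔ y' = y := by constructor <;> intro h <;> omega
  simp only [downs_append, h, downs, step_true, step_false, e]
  simp
  ring

lemma visits_insert_loop (y p : ℤ) (a b : List Bool) (h : p + disp a = y) :
    visits y p (a ++ true :: false :: b) = visits y p (a ++ b) + 1 := by
  induction a generalizing p with
  | nil =>
    simp only [disp_nil, add_zero] at h
    subst h
    simp [visits]
    ring
  | cons c a ih =>
    simp only [List.cons_append, visits]
    rw [ih _ (by rw [← h]; simp [add_assoc]), add_assoc]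

/-- No existing loop is broken: one straddling the insertion point would have its up-step from `y`
just before it, but then that point would be at `y + 1`. -/
lemma loops_insert_loop (y p : ℤ) (a b : List Bool) (h : p + disp a = y) :
    loops y p (a ++ true :: false :: b) = loops y p (a ++ b) + 1 := by
  induction a generalizing p with
  | nil =>
    simp only [disp_nil, add_zero] at h
    subst h
    simp [loops]
    ring
  | cons c a ih =>
    simp only [List.cons_append, loops]
    rw [ih _ (by rw [← h]; simp [add_assoc]), ← add_assoc]
    congr 2
    cases a with
    | nil =>
      have : ¬ (p = y ∧ c = true) := by
        rintro ⟨rfl, rfl⟩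
        simp at h
      rw [if_neg (by tauto), if_neg (by tauto)]
    | cons c' a => simp

lemma downs_le_visits (y p : ℤ) (l : List Bool) : downs y p l ≤ visits y p l := by
  -- Strengthened for the induction: a visit at the starting point is not produced by a down-step.
  suffices H : ∀ p, downs y p l + (if p = y then 1 else 0) ≤ visits y p l from
    le_trans (Nat.le_add_right _ _) (H p)
  induction l with
  | nil => intro p; simp [downs, visits]
  | cons c l ih =>
    intro p
    have := ih (p + step c)
    simp only [downs, visits]
    by_cases h : p = y + 1 ∧ c = false
    · obtain ⟨rfl, rfl⟩ := h
      simp at this ⊢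
      omega
    · rw [if_neg h]
      omega

lemma abs_le_of_downs_pos (y p : ℤ) (l : List Bool) (h : 0 < downs y p l) :
    |y - p| ≤ l.length := by
  induction l generalizing p with
  | nil => simp [downs] at h
  | cons c l ih =>
    have hs : |step c| = 1 := by cases c <;> rfl
    simp only [downs] at h
    by_cases hc : p = y + 1 ∧ c = false
    · obtain ⟨rfl, rfl⟩ := hc
      simp
    · rw [if_neg hc, zero_add] at h
      have h2 := ih _ h
      have h3 := abs_add_le (y - (p + step c)) (step c)
      rw [show y - (p + step c) + step c = y - p by ring, hs] at h3
      push_cast [List.length_cons]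
      linarith

/-! ### Averages over paths: loop insertion, Kraft's inequality, a generating function -/

/-- The mean of `F` over all paths of length `n`. -/
noncomputable def avg : ℕ → (List Bool → ℝ≥0∞) → ℝ≥0∞
  | 0, F => F []
  | n + 1, F => 2⁻¹ * (avg n (fun l => F (true :: l)) + avg n (fun l => F (false :: l)))

lemma avg_mono_length {n : ℕ} {F G : List Bool → ℝ≥0∞} (h : ∀ l, l.length = n → F l ≤ G l) :
    avg n F ≤ avg n G := by
  induction n generalizing F G with
  | zero => exact h [] rfl
  | succ n ih =>
    simp only [avg]
    gcongr <;> exact ih fun l hl => h _ (by simp [hl])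

lemma avg_mono {n : ℕ} {F G : List Bool → ℝ≥0∞} (h : ∀ l, F l ≤ G l) : avg n F ≤ avg n G :=
  avg_mono_length fun l _ => h l

lemma avg_add (n : ℕ) (F G : List Bool → ℝ≥0∞) :
    avg n (fun l => F l + G l) = avg n F + avg n G := by
  induction n generalizing F G with
  | zero => rfl
  | succ n ih => simp only [avg, ih]; ring

lemma avg_const_mul (n : ℕ) (c : ℝ≥0∞) (F : List Bool → ℝ≥0∞) :
    avg n (fun l => c * F l) = c * avg n F := by
  induction n generalizing F with
  | zero => rfl
  | succ n ih => simp only [avg, ih]; ring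

lemma avg_const (n : ℕ) (c : ℝ≥0∞) : avg n (fun _ => c) = c := by
  induction n with
  | zero => rfl
  | succ n ih =>
    simp only [avg, ih, ← two_mul, ← mul_assoc]
    rw [ENNReal.inv_mul_cancel (by simp) (by simp), one_mul]

lemma avg_tsum {ι : Type*} (n : ℕ) (F : ι → List Bool → ℝ≥0∞) :
    avg n (fun l => ∑' i, F i l) = ∑' i, avg n (F i) := by
  induction n generalizing F with
  | zero => rfl
  | succ n ih => simp only [avg, ih, ENNReal.tsum_mul_left, ENNReal.tsum_add]

/-- Inserting a loop at a marked visit to `y` yields a path with a marked loop. -/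
lemma avg_visits_le_avg_loops (y p : ℤ) (n : ℕ) (G H : List Bool → ℝ≥0∞)
    (hGH : ∀ a b, p + disp a = y → H (a ++ b) ≤ G (a ++ true :: false :: b)) :
    avg n (fun l => visits y p l * H l) ≤ 4 * avg (n + 2) (fun l => loops y p l * G l) := by
  have h4 : (4 : ℝ≥0∞) = 2 * 2 := by norm_num
  have h2 : (2 : ℝ≥0∞) * 2⁻¹ = 1 := ENNReal.mul_inv_cancel (by simp) (by simp)
  induction n generalizing p G H with
  | zero =>
    by_cases hp : p = y
    · subst hp
      have := hGH [] [] (by simp)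
      simp only [List.nil_append] at this
      simp only [avg, visits, loops, if_true, Nat.cast_one, one_mul, h4]
      calc H [] ≤ (2 * 2⁻¹) * (2 * 2⁻¹) * G [true, false] := by rw [h2]; simpa using this
        _ ≤ _ := by
          simp only [mul_assoc, mul_add]
          simp
          ring_nf
          rfl
    · simp [avg, visits, hp]
  | succ n ih =>
    have hc : ∀ c, avg n (fun l => visits y (p + step c) l * H (c :: l)) ≤
        4 * avg (n + 2) (fun l => loops y (p + step c) l * G (c :: l)) := fun c =>
      ih (p + step c) (fun l => G (c :: l)) (fun l => H (c :: l)) fun a b hab => by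
        simpa using hGH (c :: a) b (by simpa [add_assoc] using hab)
    have hT := hc true
    have hF := hc false
    by_cases hp : p = y
    -- The mark is either at the starting point, where the inserted loop occupies the first two
    -- steps and has probability 1/4, or in the tail, which the induction covers.
    · have hb : avg (n + 1) H ≤ avg (n + 1) (fun b => G (true :: false :: b)) :=
        avg_mono fun b => by simpa using hGH [] b (by simpa using hp)
      have e1 : avg (n + 1) (fun l => visits y p l * H l) = avg (n + 1) H + 2⁻¹ *
          (avg n (fun l => visits y (p + step true) l * H (true :: l)) +
          avg n (fun l => visits y (p + step false) l * H (false :: l))) := by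
        simp only [avg, visits, hp, if_true, Nat.cast_add, Nat.cast_one, add_mul, one_mul, avg_add]
        ring
      have e2 : avg (n + 3) (fun l => loops y p l * G l) =
          4⁻¹ * avg (n + 1) (fun b => G (true :: false :: b)) + 2⁻¹ *
          (avg (n + 2) (fun l => loops y (p + step true) l * G (true :: l)) +
          avg (n + 2) (fun l => loops y (p + step false) l * G (false :: l))) := by
        have : (4 : ℝ≥0∞)⁻¹ = 2⁻¹ * 2⁻¹ := by
          rw [← ENNReal.mul_inv (by simp) (by simp), h4]
        have e3 : avg (n + 2) (fun l => ((if l.head? = some false then 1 else 0 : ℕ) : ℝ≥0∞) *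
            G (true :: l)) = 2⁻¹ * avg (n + 1) (fun b => G (true :: false :: b)) := by
          rw [avg]
          simp [avg_const]
        rw [avg, this]
        simp only [loops, hp, true_and, Nat.cast_add, add_mul, avg_add]
        rw [e3]
        simp [avg_const]
        ring
      rw [e1, e2]
      calc _ ≤ avg (n + 1) (fun b => G (true :: false :: b)) + 2⁻¹ *
          (4 * avg (n + 2) (fun l => loops y (p + step true) l * G (true :: l)) +
          4 * avg (n + 2) (fun l => loops y (p + step false) l * G (false :: l))) := by gcongr
        _ = (4 * 4⁻¹) * avg (n + 1) (fun b => G (true :: false :: b)) + 2⁻¹ *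
          (4 * avg (n + 2) (fun l => loops y (p + step true) l * G (true :: l)) +
          4 * avg (n + 2) (fun l => loops y (p + step false) l * G (false :: l))) := by
          rw [ENNReal.mul_inv_cancel (by simp) (by simp), one_mul]
        _ = _ := by ring
    · rw [avg, avg]
      simp only [visits, loops, hp, if_false, false_and, zero_add]
      calc _ ≤ 2⁻¹ *
          (4 * avg (n + 2) (fun l => loops y (p + step true) l * G (true :: l)) +
          4 * avg (n + 2) (fun l => loops y (p + step false) l * G (false :: l))) := by gcongr
        _ = _ := by ring

/-- Kraft's inequality. -/
lemma tsum_avg_le_one (A : List Bool → Prop) [DecidablePred A]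
    (hA : ∀ l m, m ≠ [] → A l → ¬ A (l ++ m)) :
    ∑' n, avg n (fun l => if A l then 1 else 0) ≤ 1 := by
  rw [ENNReal.tsum_eq_iSup_nat]
  refine iSup_le fun N => ?_
  induction N generalizing A with
  | zero => simp
  | succ N ih =>
    rw [Finset.sum_range_succ']
    by_cases h0 : A []
    · have : ∀ l c, ¬ A (c :: l) := fun l c => by simpa using hA [] (c :: l) (by simp) h0
      simp [avg, this, h0, avg_const]
    · simp only [avg, h0, if_false, add_zero, ← Finset.mul_sum, Finset.sum_add_distrib]
      have hc : ∀ c, ∑ n ∈ Finset.range N, avg n (fun l => if A (c :: l) then 1 else 0) ≤ 1 :=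
        fun c => ih (fun l => A (c :: l)) fun l m hm hl => by simpa using hA (c :: l) m hm hl
      calc _ ≤ 2⁻¹ * ((1 : ℝ≥0∞) + 1) := by gcongr <;> exact hc _
        _ = 1 := by
          rw [one_add_one_eq_two]
          exact ENNReal.inv_mul_cancel (by simp) (by simp)

/-- From `y` the path makes a loop with probability 1/4 (factor `x * q`), goes up twice with
probability 1/4, or goes down with probability 1/2 (factor `q` each). The total `q * (3 + x) / 4` is
at most 1, so the weight is a supermartingale. The induction is strong because some cases consume
two steps. -/
lemma avg_pow_loops_mul_pow_visits_le_one (x q : ℝ≥0∞) (hq : q ≤ 1) (hx : q * (3 + x) ≤ 4)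
    (y : ℤ) (n : ℕ) (p : ℤ) :
    avg n (fun l => x ^ loops y p l * q ^ visits y p l) ≤ 1 := by
  have h2 : (2 : ℝ≥0∞) * 2⁻¹ = 1 := ENNReal.mul_inv_cancel (by simp) (by simp)
  have half : ∀ u v : ℝ≥0∞, u ≤ 1 → v ≤ 1 → 2⁻¹ * (u + v) ≤ 1 := fun u v hu hv =>
    calc 2⁻¹ * (u + v) ≤ 2⁻¹ * (1 + 1) := by gcongr
      _ = 1 := by rw [one_add_one_eq_two, mul_comm, h2]
  induction n using Nat.strong_induction_on generalizing p with
  | _ n ih =>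
  match n, ih with
  | 0, _ =>
    simp only [avg, loops, visits, pow_zero, one_mul]
    exact pow_le_one₀ (by simp) hq
  | 1, _ =>
    have hc : ∀ c, x ^ loops y p [c] * q ^ visits y p [c] ≤ 1 := fun c => by
      rw [show loops y p [c] = 0 by simp [loops], pow_zero, one_mul]
      exact pow_le_one₀ (by simp) hq
    exact half _ _ (hc _) (hc _)
  | n + 2, ih =>
    by_cases hp : p = y
    · subst hp
      have i1 := ih (n + 1) (by omega) (p + step false)
      have i2 := ih n (by omega) p
      have i3 := ih n (by omega) (p + 1 + 1)
      have eF : avg (n + 1) (fun l => x ^ loops p p (false :: l) * q ^ visits p p (false :: l)) =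
          q * avg (n + 1) (fun l =>
            x ^ loops p (p + step false) l * q ^ visits p (p + step false) l) := by
        rw [← avg_const_mul]
        congr 1
        ext l
        simp [loops, visits, pow_add]
        ring
      have eT : avg (n + 1) (fun l => x ^ loops p p (true :: l) * q ^ visits p p (true :: l)) =
          2⁻¹ * (q * avg n (fun l => x ^ loops p (p + 1 + 1) l * q ^ visits p (p + 1 + 1) l) +
            x * q * avg n (fun l => x ^ loops p p l * q ^ visits p p l)) := by
        rw [avg, ← avg_const_mul, ← avg_const_mul]
        congr 3
        · ext l
          simp [loops, visits, pow_add]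
          ring
        · ext l
          simp [loops, visits, pow_add]
          ring
      rw [avg, eF, eT]
      calc _ ≤ 2⁻¹ * (2⁻¹ * (q * 1 + x * q * 1) + q * 1) := by gcongr
        _ = 2⁻¹ * (2⁻¹ * (q * 1 + x * q * 1) + (2 * 2⁻¹) * q * 1) := by rw [h2, one_mul]
        _ = 2⁻¹ * 2⁻¹ * (q * (3 + x)) := by ring
        _ ≤ 2⁻¹ * 2⁻¹ * 4 := by gcongr
        _ = (2 * 2⁻¹) * (2 * 2⁻¹) := by rw [show (4 : ℝ≥0∞) = 2 * 2 by norm_num]; ring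
        _ = 1 := by rw [h2, one_mul]
    · rw [avg]
      simp only [loops, visits, hp, if_false, false_and, zero_add]
      exact half _ _ (ih _ (by omega) _) (ih _ (by omega) _)

/-! ### Tied levels and the raising of a tied site -/

/-- The path ends with a down-step to a site which thereby reaches height `h`; four sites have
height at least `h`, exactly `j` of them exceed `h`, and none of them exceeds `h + K`. -/
def TieLevel (h j K : ℕ) (l : List Bool) : Prop :=
  l.getLast? = some false ∧ downs (disp l) 0 l = h ∧ {y | h ≤ downs y 0 l}.encard = 4 ∧
    {y | h < downs y 0 l}.encard = j ∧ ∀ y, downs y 0 l ≤ h + K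

/-- Away from `y`, the path looks like one in `TieLevel h j K`, and `y` has height `h + k`. -/
def RaisedAt (y : ℤ) (h j K k : ℕ) (l : List Bool) : Prop :=
  l.getLast? = some false ∧ disp l ≠ y ∧ downs (disp l) 0 l = h ∧ downs y 0 l = h + k ∧
    {z | z ≠ y ∧ h ≤ downs z 0 l}.encard = 3 ∧ {z | z ≠ y ∧ h < downs z 0 l}.encard = j ∧
    ∀ z, z ≠ y → downs z 0 l ≤ h + K

/-- Heights only grow, so the four sites at height at least `h` are the same for both paths. The
endpoint of the longer one is among them, hence already had height `h` before the last down-step,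
which lifts it above `h`. -/
lemma TieLevel.not_append {h j K : ℕ} {l m : List Bool} (hm : m ≠ []) (hl : TieLevel h j K l) :
    ¬ TieLevel h j K (l ++ m) := by
  rintro ⟨e1, e2, e3, -, -⟩
  obtain ⟨m, c, rfl⟩ : ∃ m' c, m = m' ++ [c] := ⟨_, _, (List.dropLast_append_getLast hm).symm⟩
  obtain rfl : c = false := by simpa [← List.append_assoc] using e1
  have hmono : ∀ y, downs y 0 l ≤ downs y 0 (l ++ (m ++ [false])) := fun y => by
    rw [downs_append]; omega
  have hsub : {y | h ≤ downs y 0 l} ⊆ {y | h ≤ downs y 0 (l ++ (m ++ [false]))} :=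
    fun y hy => le_trans hy (hmono y)
  have hfin : {y | h ≤ downs y 0 (l ++ (m ++ [false]))}.Finite :=
    Set.finite_of_encard_eq_coe (k := 4) (by simpa using e3)
  have heq := (hfin.subset hsub).eq_of_subset_of_encard_le hsub (by rw [e3, hl.2.2.1])
  have hx : disp (l ++ (m ++ [false])) ∈ {y | h ≤ downs y 0 l} := by
    rw [heq]; exact e2.ge
  have hx' : h ≤ downs (disp (l ++ (m ++ [false]))) 0 l := hx
  rw [downs_append, downs_append] at e2
  simp [downs] at e2 hx'
  rw [if_pos (by ring)] at e2
  omega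

open Classical in
lemma tsum_avg_tieLevel_le_one (h j K : ℕ) :
    ∑' n, avg n (fun l => if TieLevel h j K l then 1 else 0) ≤ 1 :=
  tsum_avg_le_one _ fun _ _ hm hl => hl.not_append hm

lemma RaisedAt.insert_loop {y : ℤ} {h j K k : ℕ} {a b : List Bool} (ha : disp a = y)
    (H : RaisedAt y h j K k (a ++ b)) : RaisedAt y h j K (k + 1) (a ++ true :: false :: b) := by
  obtain ⟨h1, h2, h3, h4, h5, h6, h7⟩ := H
  -- The endpoint differs from `y`, so the insertion is not at the end and the last step survives.
  have hb : b ≠ [] := by rintro rfl; simp [ha] at h2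
  have hd : ∀ z, downs z 0 (a ++ true :: false :: b) =
      downs z 0 (a ++ b) + if z = y then 1 else 0 :=
    fun z => downs_insert_loop y z 0 a b (by simpa using ha)
  have hd' : ∀ z, z ≠ y → downs z 0 (a ++ true :: false :: b) = downs z 0 (a ++ b) :=
    fun z hz => by rw [hd, if_neg hz, add_zero]
  have he : disp (a ++ true :: false :: b) = disp (a ++ b) := by simp
  refine ⟨?_, by rwa [he], by rw [he, hd' _ h2, h3], by rw [hd, h4, if_pos rfl, add_assoc],
    ?_, ?_, fun z hz => by rw [hd' z hz]; exact h7 z hz⟩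
  · obtain ⟨b, c, rfl⟩ : ∃ b' c, b = b' ++ [c] := ⟨_, _, (List.dropLast_append_getLast hb).symm⟩
    rw [← List.append_assoc, List.getLast?_concat] at h1
    rw [show a ++ true :: false :: (b ++ [c]) = (a ++ true :: false :: b) ++ [c] by simp,
      List.getLast?_concat, h1]
  · rw [← h5]; congr 1; ext z
    exact and_congr_right fun hz => by rw [hd' z hz]
  · rw [← h6]; congr 1; ext z
    exact and_congr_right fun hz => by rw [hd' z hz]

lemma RaisedAt.tieLevel {y : ℤ} {h j K k : ℕ} {l : List Bool} (H : RaisedAt y h j K k l)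
    (hk : 1 ≤ k) (hK : k ≤ K) : TieLevel h (j + 1) K l := by
  obtain ⟨h1, h2, h3, h4, h5, h6, h7⟩ := H
  refine ⟨h1, h3, ?_, ?_, fun z => ?_⟩
  · rw [show {z | h ≤ downs z 0 l} = insert y {z | z ≠ y ∧ h ≤ downs z 0 l} by
      ext z; by_cases hz : z = y
      · subst hz; simp [h4]
      · simp [hz], Set.encard_insert_of_notMem (by simp), h5]
    rfl
  · rw [show {z | h < downs z 0 l} = insert y {z | z ≠ y ∧ h < downs z 0 l} by
      ext z; by_cases hz : z = y
      · subst hz; simp [h4]; omega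
      · simp [hz], Set.encard_insert_of_notMem (by simp), h6]
    rfl
  · by_cases hz : z = y
    · subst hz; omega
    · exact h7 z hz

lemma TieLevel.raisedAt {y : ℤ} {h j K : ℕ} {l : List Bool} (H : TieLevel h j K l)
    (hy : downs y 0 l = h) (hne : disp l ≠ y) : RaisedAt y h j K 0 l := by
  obtain ⟨h1, h2, h3, h4, h5⟩ := H
  refine ⟨h1, hne, h2, by simpa using hy, ?_, ?_, fun z _ => h5 z⟩
  · have := Set.encard_sdiff_singleton_add_one (a := y) (s := {z | h ≤ downs z 0 l}) hy.ge
    rw [h3, show (4 : ℕ∞) = 3 + 1 by norm_num] at this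
    rw [← WithTop.add_right_cancel ENat.one_ne_top this]
    congr 1; ext z; simp [and_comm]
  · rw [← h4]; congr 1; ext z
    simp only [Set.mem_ofPred_eq, and_iff_right_iff_imp]
    rintro hz rfl; omega

/-- Of the four sites at most two exceed `h` and one is the endpoint; another must remain at height
exactly `h`. -/
lemma TieLevel.exists_eq {h j K : ℕ} {l : List Bool} (H : TieLevel h j K l) (hj : j < 3) :
    ∃ y, downs y 0 l = h ∧ disp l ≠ y := by
  obtain ⟨-, h2, h3, h4, -⟩ := H
  by_contra! hc
  have hsub : {y | h ≤ downs y 0 l} ⊆ insert (disp l) {y | h < downs y 0 l} := fun y hy => by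
    rcases eq_or_lt_of_le (show h ≤ downs y 0 l from hy) with e | e
    · exact Or.inl (hc y e.symm).symm
    · exact Or.inr e
  have := (Set.encard_le_encard hsub).trans (Set.encard_insert_le _ _)
  rw [h3, h4] at this
  have h' : 4 ≤ j + 1 := by exact_mod_cast this
  omega

/-- The loops at `y` make up at most about a quarter of the visits, up to `k` extra loops. -/
def FewLoops (y : ℤ) (h K k : ℕ) (l : List Bool) : Prop :=
  h ≤ visits y 0 l ∧ 4 * K * loops y 0 l ≤ (K + 1) * visits y 0 l + 3 * K * k

-- Dividing by the number of visits turns the marked-path inequality into one between probabilities;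
-- the ratio left over, four times loops over visits, is at most `1 + 2 / K` by `FewLoops`.
open Classical in
lemma avg_raisedAt_le_succ (y : ℤ) {h j K k : ℕ} (hK : 1 ≤ K) (hk : k < K)
    (hh : 3 * K ^ 2 + 4 * K + 2 ≤ h) (n : ℕ) :
    avg n (fun l => if RaisedAt y h j K k l ∧ FewLoops y h K k l then 1 else 0) ≤
      ((K + 2 : ℕ) / K : ℝ≥0∞) * avg (n + 2) (fun l =>
        if RaisedAt y h j K (k + 1) l ∧ FewLoops y h K (k + 1) l then 1 else 0) := by
  -- The insertion adds one visit, hence the denominator `visits - 1` on the longer path.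
  have key := avg_visits_le_avg_loops y 0 n
    (fun l => (if RaisedAt y h j K (k + 1) l ∧ FewLoops y h K (k + 1) l then 1 else 0) /
      ((visits y 0 l - 1 : ℕ) : ℝ≥0∞))
    (fun l => (if RaisedAt y h j K k l ∧ FewLoops y h K k l then 1 else 0) /
      (visits y 0 l : ℝ≥0∞)) (fun a b hab => by
      have hv := visits_insert_loop y 0 a b hab
      have hl := loops_insert_loop y 0 a b hab
      simp only [hv, Nat.add_sub_cancel]
      gcongr
      split_ifs with h1 h2
      · exact le_rfl
      · refine absurd ⟨h1.1.insert_loop (by simpa using hab), ?_, ?_⟩ h2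
        · rw [hv]; exact h1.2.1.trans (Nat.le_succ _)
        -- One insertion adds `4 * K` on the left and `(K + 1) + 3 * K` on the right; the term `3 *
        -- K * k` is there for this.
        · have := h1.2.2
          rw [hv, hl]
          nlinarith
      · simp
      · simp)
  refine le_trans ?_ (key.trans ?_)
  · refine avg_mono fun l => ?_
    split_ifs with h1
    · have : visits y 0 l ≠ 0 := by have := h1.2.1; omega
      rw [ENNReal.mul_div_cancel (by exact_mod_cast this) (by simp)]
    · simp
  · rw [← avg_const_mul, ← avg_const_mul]
    refine avg_mono fun l => ?_
    split_ifs with h1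
    · obtain ⟨h2, h3⟩ := h1.2
      obtain ⟨v, hv⟩ : ∃ v, visits y 0 l = v + 1 := ⟨visits y 0 l - 1, by omega⟩
      rw [hv] at h2 h3 ⊢
      have hv0 : v ≠ 0 := by omega
      rw [Nat.add_sub_cancel, mul_one, ← mul_div_assoc, mul_one, ← mul_div_assoc,
        ENNReal.div_le_iff (by exact_mod_cast hv0) (by simp), ENNReal.mul_comm_div,
        ← mul_div_assoc, ENNReal.le_div_iff_mul_le (by left; positivity) (by simp)]
      -- With `k + 1 ≤ K`, the additive terms are at most `3 * K ^ 2 + K + 1 ≤ v`, so they fit into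
      -- replacing `K + 1` by `K + 2`.
      have hkK : K * k + K ≤ K * K := by nlinarith
      have : 4 * loops y 0 l * K ≤ (K + 2) * v := by nlinarith
      exact_mod_cast this
    · simp

open Classical in
lemma avg_raisedAt_le (y : ℤ) {h j K : ℕ} (hK : 1 ≤ K)
    (hh : 3 * K ^ 2 + 4 * K + 2 ≤ h) (k : ℕ) (hk : k ≤ K) (n : ℕ) :
    avg n (fun l => if RaisedAt y h j K 0 l ∧ FewLoops y h K 0 l then 1 else 0) ≤
      9 * avg (n + 2 * k) (fun l => if RaisedAt y h j K k l then 1 else 0) := by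
  have hc1 : (1 : ℝ≥0∞) ≤ (K + 2 : ℕ) / K := by
    rw [ENNReal.le_div_iff_mul_le (by left; positivity) (by simp), one_mul]
    exact_mod_cast (by omega : K ≤ K + 2)
  -- `(1 + 2 / K) ^ K ≤ e ^ 2 ≤ 9`.
  have hc9 : ((K + 2 : ℕ) / K : ℝ≥0∞) ^ K ≤ 9 := by
    have hKr : (0 : ℝ) < K := by exact_mod_cast hK
    have e : ((K + 2 : ℕ) / K : ℝ≥0∞) = ENNReal.ofReal (2 / K + 1) := by
      rw [show (2 / K + 1 : ℝ) = (K + 2 : ℕ) / (K : ℝ) by push_cast; field_simp; ring,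
        ENNReal.ofReal_div_of_pos hKr, ENNReal.ofReal_natCast, ENNReal.ofReal_natCast]
    rw [e, ← ENNReal.ofReal_pow (by positivity),
      show (9 : ℝ≥0∞) = ENNReal.ofReal 9 by norm_num]
    refine ENNReal.ofReal_le_ofReal ?_
    calc (2 / K + 1 : ℝ) ^ K ≤ Real.exp (2 / K) ^ K := by
          gcongr; exact Real.add_one_le_exp _
      _ = Real.exp 1 ^ 2 := by
          rw [← Real.exp_nat_mul, ← Real.exp_nat_mul]; congr 1; push_cast; field_simp
      _ ≤ 3 ^ 2 := by gcongr; exact Real.exp_one_lt_d9.le.trans (by norm_num)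
      _ = 9 := by norm_num
  have main : ∀ k ≤ K, avg n (fun l => if RaisedAt y h j K 0 l ∧ FewLoops y h K 0 l then 1 else 0) ≤
      ((K + 2 : ℕ) / K : ℝ≥0∞) ^ k * avg (n + 2 * k) (fun l =>
        if RaisedAt y h j K k l ∧ FewLoops y h K k l then 1 else 0) := by
    intro k
    induction k with
    | zero => intro _; simp
    | succ k ih =>
      intro hk
      refine (ih (by omega)).trans ?_
      rw [pow_succ, mul_assoc]
      gcongr
      exact avg_raisedAt_le_succ y hK hk hh (n + 2 * k)
  refine (main k hk).trans ?_
  gcongr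
  · exact (pow_le_pow_right₀ hc1 hk).trans hc9
  · refine avg_mono fun l => ?_
    split_ifs with h1 h2 <;> simp_all

lemma tsum_ite_eq_encard (P : ℤ → Prop) [DecidablePred P] :
    ∑' y, (if P y then (1 : ℝ≥0∞) else 0) = {y | P y}.encard := by
  rw [← ENNReal.tsum_set_one, tsum_subtype {y | P y} (fun _ => (1 : ℝ≥0∞))]
  simp [Set.indicator_apply]

open Classical in
/-- The contribution of the paths in which too many visits to a site at level `h` are followed by
an immediate loop. -/
noncomputable def manyLoopsWeight (h j K : ℕ) : ℝ≥0∞ :=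
  ∑' n, ∑' y, avg n (fun l => if TieLevel h j K l ∧ h ≤ downs y 0 l ∧
    (K + 1) * visits y 0 l < 4 * K * loops y 0 l then 1 else 0)

open Classical in
/-- Raising a site from height `h` to one of the heights `h + 1, …, h + K`. -/
lemma mul_tsum_avg_tieLevel_le {h j K : ℕ} (hK : 1 ≤ K) (hj : j < 3)
    (hh : 3 * K ^ 2 + 4 * K + 2 ≤ h) :
    K * ∑' n, avg n (fun l => if TieLevel h j K l then 1 else 0) ≤
      K * manyLoopsWeight h j K +
        9 * (j + 1) * ∑' n, avg n (fun l => if TieLevel h (j + 1) K l then 1 else 0) := by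
  have split : ∀ n, avg n (fun l => if TieLevel h j K l then 1 else 0) ≤
      ∑' y, avg n (fun l => if TieLevel h j K l ∧ h ≤ downs y 0 l ∧
        (K + 1) * visits y 0 l < 4 * K * loops y 0 l then 1 else 0) +
      ∑' y, avg n (fun l => if RaisedAt y h j K 0 l ∧ FewLoops y h K 0 l then 1 else 0) := by
    intro n
    rw [← avg_tsum, ← avg_tsum, ← avg_add]
    refine avg_mono fun l => ?_
    split_ifs with hl
    · obtain ⟨y, hy, hne⟩ := hl.exists_eq hj
      by_cases hb : (K + 1) * visits y 0 l < 4 * K * loops y 0 l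
      · refine le_add_right (le_trans ?_ (ENNReal.le_tsum y))
        rw [if_pos ⟨hl, hy.ge, hb⟩]
      · refine le_add_left (le_trans ?_ (ENNReal.le_tsum y))
        rw [if_pos ⟨hl.raisedAt hy hne, hy.ge.trans (downs_le_visits y 0 l), by omega⟩]
    · simp
  have hgood : ∀ y, K * ∑' n, avg n (fun l =>
        if RaisedAt y h j K 0 l ∧ FewLoops y h K 0 l then 1 else 0) ≤
      9 * ∑' n, avg n (fun l => if TieLevel h (j + 1) K l ∧ h < downs y 0 l then 1 else 0) := by
    intro y
    calc K * ∑' n, avg n (fun l => if RaisedAt y h j K 0 l ∧ FewLoops y h K 0 l then 1 else 0)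
        = ∑ k ∈ Finset.Icc 1 K, ∑' n, avg n (fun l =>
            if RaisedAt y h j K 0 l ∧ FewLoops y h K 0 l then 1 else 0) := by simp
      _ ≤ ∑ k ∈ Finset.Icc 1 K, 9 * ∑' n, avg n (fun l =>
            if RaisedAt y h j K k l then 1 else 0) := by
          refine Finset.sum_le_sum fun k hk => ?_
          rw [Finset.mem_Icc] at hk
          refine (ENNReal.tsum_le_tsum fun n => avg_raisedAt_le y hK hh k hk.2 n).trans ?_
          rw [ENNReal.tsum_mul_left]
          exact mul_le_mul' le_rfl (ENNReal.tsum_comp_le_tsum_of_injective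
            (f := fun n => n + 2 * k) (fun a b hab => by simpa using hab)
            (fun n => avg n (fun l => if RaisedAt y h j K k l then 1 else 0)))
      _ = 9 * ∑' n, ∑ k ∈ Finset.Icc 1 K, avg n (fun l =>
            if RaisedAt y h j K k l then 1 else 0) := by
          rw [← Finset.mul_sum, Summable.tsum_finsetSum fun _ _ => ENNReal.summable]
      _ ≤ _ := by
          gcongr with n
          rw [show ∑ k ∈ Finset.Icc 1 K, avg n (fun l => if RaisedAt y h j K k l then 1 else 0) =
            avg n (fun l => ∑ k ∈ Finset.Icc 1 K, if RaisedAt y h j K k l then 1 else 0) by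
              simp_rw [← Finset.tsum_subtype, avg_tsum]]
          refine avg_mono fun l => ?_
          -- For fixed `y` the events for different `k` are disjoint, since the height of `y` is `h
          -- + k`. The K copies thus fit into a single tie event, which yields the gain 1/K.
          by_cases hl : ∃ k ∈ Finset.Icc 1 K, RaisedAt y h j K k l
          · obtain ⟨k, hk, hR⟩ := hl
            have hk' := Finset.mem_Icc.1 hk
            rw [Finset.sum_eq_single_of_mem k hk fun k' _ hne => if_neg fun hR' => hne <| by
              have := hR.2.2.2.1; have := hR'.2.2.2.1; omega, if_pos hR,
              if_pos ⟨hR.tieLevel hk'.1 hk'.2, by have := hR.2.2.2.1; omega⟩]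
          · push Not at hl
            rw [Finset.sum_eq_zero fun k hk => if_neg (hl k hk)]
            simp
  calc K * ∑' n, avg n (fun l => if TieLevel h j K l then 1 else 0)
      ≤ K * (manyLoopsWeight h j K + ∑' n, ∑' y, avg n (fun l =>
          if RaisedAt y h j K 0 l ∧ FewLoops y h K 0 l then 1 else 0)) := by
        gcongr
        rw [manyLoopsWeight, ← ENNReal.tsum_add]
        exact ENNReal.tsum_le_tsum split
    _ = K * manyLoopsWeight h j K + ∑' y, K * ∑' n, avg n (fun l =>
          if RaisedAt y h j K 0 l ∧ FewLoops y h K 0 l then 1 else 0) := by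
        rw [mul_add, ENNReal.tsum_comm, ENNReal.tsum_mul_left]
    _ ≤ K * manyLoopsWeight h j K + ∑' y, 9 * ∑' n, avg n (fun l =>
          if TieLevel h (j + 1) K l ∧ h < downs y 0 l then 1 else 0) :=
        add_le_add le_rfl (ENNReal.tsum_le_tsum hgood)
    _ ≤ _ := by
        rw [ENNReal.tsum_mul_left, ENNReal.tsum_comm, mul_assoc,
          ← ENNReal.tsum_mul_left (a := (j + 1 : ℝ≥0∞))]
        refine add_le_add le_rfl (mul_le_mul' le_rfl (ENNReal.tsum_le_tsum fun n => ?_))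
        rw [← avg_tsum, ← avg_const_mul]
        refine avg_mono fun l => ?_
        by_cases hl : TieLevel h (j + 1) K l
        -- A path is reached from at most `j + 1` sites `y`, those that exceed `h`.
        · simp only [hl, true_and, if_true, mul_one]
          refine (tsum_ite_eq_encard _).le.trans ?_
          rw [hl.2.2.2.1]
          push_cast
          exact le_rfl
        · simp [hl]

/-! ### Large deviations -/

open Classical in
/-- A Chernoff bound: about a quarter of the visits to `y` are followed by an immediate loop. -/
lemma avg_many_loops_le (y : ℤ) {h K : ℕ} (hK : 1 ≤ K) (n : ℕ) :
    avg n (fun l => if h ≤ visits y 0 l ∧ (K + 1) * visits y 0 l < 4 * K * loops y 0 l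
      then 1 else 0) ≤ ENNReal.ofReal (Real.exp (-(h / (16 * K ^ 2)))) := by
  have hKr : (1 : ℝ) ≤ K := by exact_mod_cast hK
  have hK0 : (0 : ℝ) < K := by linarith
  -- Per visit, the exponent gains at least `(t / K - t ^ 2) / 4`; this `t` maximizes it, with value
  -- `1 / (16 * K ^ 2)`.
  set t : ℝ := 1 / (2 * K) with ht
  have ht0 : 0 < t := by positivity
  have ht1 : t ≤ 1 := by rw [ht, div_le_one (by positivity)]; linarith
  set u : ℝ := (t + t ^ 2) / 4 with hu
  have hu0 : 0 < u := by positivity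
  have hexp : Real.exp t ≤ 1 + t + t ^ 2 := by
    have := Real.abs_exp_sub_one_sub_id_le (x := t) (by rwa [abs_of_pos ht0])
    have := (abs_le.1 this).2
    linarith
  have hmain := avg_pow_loops_mul_pow_visits_le_one (ENNReal.ofReal (Real.exp t))
    (ENNReal.ofReal (Real.exp (-u))) (by simpa using hu0.le) (by
      rw [show (3 : ℝ≥0∞) = ENNReal.ofReal 3 by norm_num,
        show (4 : ℝ≥0∞) = ENNReal.ofReal 4 by norm_num,
        ← ENNReal.ofReal_add (by norm_num) (by positivity),
        ← ENNReal.ofReal_mul (by positivity)]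
      refine ENNReal.ofReal_le_ofReal ?_
      calc Real.exp (-u) * (3 + Real.exp t) ≤ Real.exp (-u) * (4 * (u + 1)) := by
            gcongr; rw [hu]; linarith
        _ ≤ Real.exp (-u) * (4 * Real.exp u) := by gcongr; exact Real.add_one_le_exp u
        _ = 4 := by rw [Real.exp_neg]; field_simp) y n 0
  calc _ ≤ avg n (fun l => ENNReal.ofReal (Real.exp (-(h / (16 * K ^ 2)))) *
        (ENNReal.ofReal (Real.exp t) ^ loops y 0 l *
          ENNReal.ofReal (Real.exp (-u)) ^ visits y 0 l)) := by
        refine avg_mono fun l => ?_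
        split_ifs with hl
        · obtain ⟨h1, h2⟩ := hl
          have h1' : (h : ℝ) ≤ visits y 0 l := by exact_mod_cast h1
          have h2' : ((K : ℝ) + 1) * visits y 0 l < 4 * K * loops y 0 l := by exact_mod_cast h2
          rw [← ENNReal.ofReal_pow (by positivity), ← ENNReal.ofReal_pow (by positivity),
            ← ENNReal.ofReal_mul (by positivity), ← ENNReal.ofReal_mul (by positivity),
            ← Real.exp_nat_mul, ← Real.exp_nat_mul, ← Real.exp_add, ← Real.exp_add,
            ENNReal.one_le_ofReal, Real.one_le_exp_iff]
          generalize (visits y 0 l : ℝ) = V at *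
          generalize (loops y 0 l : ℝ) = L at *
          have e1 : ((K : ℝ) + 1) * V / (4 * K) ≤ L := by
            rw [div_le_iff₀ (by positivity)]; linarith
          have e2 : ((K : ℝ) + 1) * V / (4 * K) * t + V * -u = V / (16 * K ^ 2) := by
            rw [hu, ht]; field_simp; ring
          have e3 : (h : ℝ) / (16 * K ^ 2) ≤ V / (16 * K ^ 2) := by gcongr
          have e4 := mul_le_mul_of_nonneg_right e1 ht0.le
          linarith
        · simp
    _ ≤ _ := by
        rw [avg_const_mul]
        calc _ ≤ ENNReal.ofReal (Real.exp (-(h / (16 * K ^ 2)))) * 1 := by gcongr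
          _ = _ := mul_one _

/-- The path started at `p` visits a site at distance at least `r` from the origin. -/
def Exceeds (r : ℕ) : ℤ → List Bool → Prop
  | p, [] => (r : ℤ) ≤ |p|
  | p, c :: l => (r : ℤ) ≤ |p| ∨ Exceeds r (p + step c) l

-- A maximal inequality: `cosh (t * p)` is multiplied by `cosh t` on average at each step, and the
-- path is stopped on reaching distance `r`.
open Classical in
lemma avg_exceeds_le (r : ℕ) (t : ℝ) (n : ℕ) (p : ℤ) :
    avg n (fun l => if Exceeds r p l then 1 else 0) ≤
      ENNReal.ofReal (Real.cosh t ^ n * Real.cosh (t * p) / Real.cosh (t * r)) := by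
  have hfar : ∀ (n : ℕ) (p : ℤ), (r : ℤ) ≤ |p| →
      1 ≤ Real.cosh t ^ n * Real.cosh (t * p) / Real.cosh (t * r) := by
    intro n p hp
    rw [le_div_iff₀ (Real.cosh_pos _), one_mul]
    have h1 : Real.cosh (t * r) ≤ Real.cosh (t * p) := by
      rw [Real.cosh_le_cosh, abs_mul, abs_mul]
      refine mul_le_mul_of_nonneg_left ?_ (abs_nonneg t)
      rw [Nat.abs_cast]
      exact_mod_cast hp
    exact h1.trans (le_mul_of_one_le_left (Real.cosh_pos _).le
      (one_le_pow₀ (Real.one_le_cosh t)))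
  induction n generalizing p with
  | zero =>
    rw [avg]
    split_ifs with hp
    · rw [ENNReal.one_le_ofReal]; exact hfar 0 p hp
    · exact zero_le
  | succ n ih =>
    by_cases hp : (r : ℤ) ≤ |p|
    · refine le_trans ?_ (ENNReal.one_le_ofReal.2 (hfar (n + 1) p hp))
      calc _ ≤ avg (n + 1) (fun _ => 1) := avg_mono fun l => by split_ifs <;> simp
        _ = 1 := avg_const _ _
    · simp only [avg, Exceeds, hp, false_or]
      calc _ ≤ 2⁻¹ * (ENNReal.ofReal
              (Real.cosh t ^ n * Real.cosh (t * (p + step true : ℤ)) / Real.cosh (t * r)) +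
            ENNReal.ofReal
              (Real.cosh t ^ n * Real.cosh (t * (p + step false : ℤ)) / Real.cosh (t * r))) := by
            gcongr <;> exact ih _
        _ = _ := by
            have h0 : ∀ x, 0 ≤ Real.cosh x := fun x => (Real.cosh_pos x).le
            rw [← ENNReal.ofReal_add
                (div_nonneg (mul_nonneg (pow_nonneg (h0 _) _) (h0 _)) (h0 _))
                (div_nonneg (mul_nonneg (pow_nonneg (h0 _) _) (h0 _)) (h0 _)),
              show (2⁻¹ : ℝ≥0∞) = ENNReal.ofReal 2⁻¹ by
                rw [ENNReal.ofReal_inv_of_pos (by norm_num)]; norm_num,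
              ← ENNReal.ofReal_mul (by norm_num)]
            congr 1
            have e1 : t * ((p + step true : ℤ) : ℝ) = t * p + t := by simp; ring
            have e2 : t * ((p + step false : ℤ) : ℝ) = t * p - t := by simp; ring
            rw [e1, e2, Real.cosh_add, Real.cosh_sub]
            ring

lemma disp_eq_length_sub (l : List Bool) : disp l = l.length - 2 * l.count false := by
  induction l with
  | nil => simp
  | cons c l ih => cases c <;> simp [ih] <;> ring

lemma count_false_le_sum_downs {r : ℕ} {p : ℤ} {l : List Bool} (h : ¬ Exceeds r p l) :
    l.count false ≤ ∑ y ∈ Finset.Ioo (-r : ℤ) r, downs y p l ∧ |p + disp l| < r := by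
  induction l generalizing p with
  | nil => simpa [Exceeds, downs] using h
  | cons c l ih =>
    simp only [Exceeds, not_or, not_le] at h
    obtain ⟨h1, h2⟩ := ih h.2
    refine ⟨?_, by simpa [add_assoc] using h2⟩
    simp only [downs, Finset.sum_add_distrib]
    cases c
    · have hp : p - 1 ∈ Finset.Ioo (-r : ℤ) r := by
        have h3 : |p + step false| < (r : ℤ) := by
          cases l with
          | nil => simpa [Exceeds] using h.2
          | cons c l => simp only [Exceeds, not_or, not_le] at h; exact h.2.1
        rw [Finset.mem_Ioo]
        exact abs_lt.1 h3
      have h4 : 1 ≤ ∑ y ∈ Finset.Ioo (-r : ℤ) r, (if p = y + 1 ∧ false = false then 1 else 0) :=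
        le_trans (by simp) (Finset.single_le_sum
          (f := fun y => if p = y + 1 ∧ false = false then 1 else 0) (fun _ _ => by simp) hp)
      rw [List.count_cons_self]
      omega
    · simp only [List.count_cons, beq_iff_eq, Bool.true_eq_false, if_false]
      omega

/-- A path confined to (-r, r) makes at most `2 * r * H` down-steps, and its displacement below `r`
forces nearly half of its steps to be down-steps, so it is short. -/
lemma exceeds_of_downs_le {r H : ℕ} {l : List Bool} (hH : ∀ y, downs y 0 l ≤ H)
    (hr : r + 4 * r * H ≤ l.length) : Exceeds r 0 l := by
  by_contra hc
  obtain ⟨h1, h2⟩ := count_false_le_sum_downs hc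
  have h3 : ∑ y ∈ Finset.Ioo (-r : ℤ) r, downs y 0 l ≤ 2 * r * H := by
    refine (Finset.sum_le_card_nsmul _ _ H fun y _ => hH y).trans ?_
    rw [smul_eq_mul, Int.card_Ioo]
    gcongr
    omega
  rw [zero_add, disp_eq_length_sub] at h2
  have := (abs_lt.1 h2).2
  have h4 : l.count false ≤ 2 * r * H := h1.trans h3
  have h5 : 4 * r * H = 2 * (2 * r * H) := by ring
  omega

open Classical in
/-- A long path visits some site often. -/
lemma avg_downs_le_le {h n : ℕ} (hh : 1 ≤ h) (hn : 10 * h ≤ n) :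
    avg n (fun l => if ∀ y, downs y 0 l ≤ 2 * h then 1 else 0) ≤
      ENNReal.ofReal (2 * Real.exp (-(n / (800 * h ^ 2)))) := by
  -- Chosen so that `r + 4 * r * (2 * h) ≤ n`: a path with heights at most `2 * h` must then leave
  -- (-r, r).
  set r := n / (10 * h) with hr
  have hr1 : r * (10 * h) ≤ n := Nat.div_mul_le_self _ _
  have hr2 : n < (r + 1) * (10 * h) := by
    have := Nat.lt_div_mul_add (a := n) (b := 10 * h) (by omega)
    rw [hr]; linarith
  have hr0 : 1 ≤ r := (Nat.one_le_div_iff (by omega)).2 hn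
  have hhr : (1 : ℝ) ≤ h := by exact_mod_cast hh
  have hnr : (0 : ℝ) < n := by exact_mod_cast (by omega : 0 < n)
  have hr3 : (n : ℝ) / (20 * h) ≤ r := by
    rw [div_le_iff₀ (by positivity)]
    have : n ≤ r * (20 * h) := by nlinarith
    exact_mod_cast this
  calc _ ≤ avg n (fun l => if Exceeds r 0 l then 1 else 0) := by
        refine avg_mono_length fun l hl => ?_
        split_ifs with h1 h2
        · exact le_rfl
        · refine absurd (exceeds_of_downs_le h1 ?_) h2
          rw [hl]
          nlinarith
        · simp
        · simp
    -- `t = r / n` maximizes `t * r - n * t ^ 2 / 2`.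
    _ ≤ _ := avg_exceeds_le r (r / n) n 0
    _ ≤ _ := by
        refine ENNReal.ofReal_le_ofReal ?_
        rw [Int.cast_zero, mul_zero, Real.cosh_zero, mul_one]
        have h1 : Real.cosh (r / n) ^ n ≤ Real.exp (r ^ 2 / (2 * n)) := by
          calc Real.cosh (r / n) ^ n ≤ Real.exp ((r / n) ^ 2 / 2) ^ n := by
                gcongr
                exact Real.cosh_le_exp_half_sq _
            _ = _ := by rw [← Real.exp_nat_mul]; congr 1; field_simp
        have h2 : Real.exp (r ^ 2 / n) / 2 ≤ Real.cosh (r / n * r) := by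
          rw [Real.cosh_eq, show (r : ℝ) / n * r = r ^ 2 / n by ring]
          have := Real.exp_pos (-((r : ℝ) ^ 2 / n))
          linarith
        calc _ ≤ Real.exp (r ^ 2 / (2 * n)) / (Real.exp (r ^ 2 / n) / 2) := by gcongr
          _ = 2 * Real.exp (-(r ^ 2 / (2 * n))) := by
              rw [show -((r : ℝ) ^ 2 / (2 * n)) = r ^ 2 / (2 * n) - r ^ 2 / n by field_simp; ring,
                Real.exp_sub]
              field_simp
          _ ≤ _ := by
              refine mul_le_mul_of_nonneg_left (Real.exp_le_exp.2 (neg_le_neg ?_)) zero_le_two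
              calc (n : ℝ) / (800 * h ^ 2) = (n / (20 * h)) ^ 2 / (2 * n) := by field_simp; ring
                _ ≤ _ := by gcongr

lemma exp_neg_le_factorial_div (m : ℕ) {x : ℝ} (hx : 0 < x) :
    Real.exp (-x) ≤ m.factorial / x ^ m := by
  have h := Real.pow_div_factorial_le_exp x hx.le m
  rw [Real.exp_neg, ← inv_div]
  exact inv_anti₀ (by positivity) h

/-- For lengths below `h ^ 3`, a union bound over the reachable sites and the Chernoff estimate
suffice. For longer paths, it is already unlikely that all heights stay below `h + K ≤ 2 * h`; the 4
counts the sites of height at least `h`. -/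
lemma manyLoopsWeight_le_add {h j K : ℕ} (hK : 1 ≤ K) (hKh : K ≤ h) (hh : 10 ≤ h) :
    manyLoopsWeight h j K ≤
      ((h ^ 3 * (2 * h ^ 3 + 1) : ℕ) : ℝ≥0∞) *
        ENNReal.ofReal (Real.exp (-(h / (16 * K ^ 2)))) +
      4 * ∑' n : ℕ, if h ^ 3 ≤ n then
        ENNReal.ofReal (2 * Real.exp (-(n / (800 * h ^ 2)))) else 0 := by
  classical
  have hsmall : ∀ n < h ^ 3, ∑' y, avg n (fun l => if TieLevel h j K l ∧ h ≤ downs y 0 l ∧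
      (K + 1) * visits y 0 l < 4 * K * loops y 0 l then 1 else 0) ≤
      ((2 * h ^ 3 + 1 : ℕ) : ℝ≥0∞) * ENNReal.ofReal (Real.exp (-(h / (16 * K ^ 2)))) := by
    intro n hn
    rw [tsum_eq_sum (s := Finset.Icc (-(h ^ 3 : ℕ) : ℤ) (h ^ 3 : ℕ)) (fun y hy => by
      rw [← nonpos_iff_eq_zero]
      refine (avg_mono_length (G := fun _ => 0) fun l hl => ?_).trans (avg_const n 0).le
      rw [if_neg]
      rintro ⟨-, h2, -⟩
      have := abs_le_of_downs_pos y 0 l (by omega)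
      rw [sub_zero, hl] at this
      have := abs_le.1 this
      refine hy (Finset.mem_Icc.2 ⟨?_, ?_⟩) <;> omega)]
    refine (Finset.sum_le_card_nsmul _ _ _ fun y _ => (avg_mono fun l => ?_).trans
      (avg_many_loops_le (h := h) y hK n)).trans ?_
    · split_ifs with h1 h2
      · exact le_rfl
      · exact absurd ⟨h1.2.1.trans (downs_le_visits y 0 l), h1.2.2⟩ h2
      · exact zero_le
      · exact zero_le
    · rw [nsmul_eq_mul, Int.card_Icc]
      gcongr
      omega
  have hlarge : ∀ n, h ^ 3 ≤ n → ∑' y, avg n (fun l => if TieLevel h j K l ∧ h ≤ downs y 0 l ∧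
      (K + 1) * visits y 0 l < 4 * K * loops y 0 l then 1 else 0) ≤
      4 * ENNReal.ofReal (2 * Real.exp (-(n / (800 * h ^ 2)))) := by
    intro n hn
    rw [← avg_tsum]
    refine le_trans (b := 4 * avg n (fun l => if ∀ y, downs y 0 l ≤ 2 * h then 1 else 0)) ?_ ?_
    · rw [← avg_const_mul]
      refine avg_mono fun l => ?_
      by_cases hl : TieLevel h j K l
      · rw [if_pos fun y => (hl.2.2.2.2 y).trans (by omega), mul_one]
        calc _ ≤ ∑' y, (if h ≤ downs y 0 l then (1 : ℝ≥0∞) else 0) :=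
              ENNReal.tsum_le_tsum fun y => by
                split_ifs with h1 h2
                · exact le_rfl
                · exact absurd h1.2.1 h2
                · exact zero_le
                · exact zero_le
          _ = _ := by
              rw [tsum_ite_eq_encard, hl.2.2.1]
              rfl
      · simp [hl]
    · refine mul_le_mul' le_rfl (avg_downs_le_le (by omega) (le_trans ?_ hn))
      nlinarith [mul_le_mul hh hh (by norm_num) (by omega)]
  calc manyLoopsWeight h j K
      ≤ ∑' n, ((if n < h ^ 3 then ((2 * h ^ 3 + 1 : ℕ) : ℝ≥0∞) *
          ENNReal.ofReal (Real.exp (-(h / (16 * K ^ 2)))) else 0) +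
        4 * (if h ^ 3 ≤ n then
          ENNReal.ofReal (2 * Real.exp (-(n / (800 * h ^ 2)))) else 0)) := by
        refine ENNReal.tsum_le_tsum fun n => ?_
        by_cases hn : n < h ^ 3
        · simp only [hn, if_true, not_le.2 hn, if_false, mul_zero, add_zero]
          exact hsmall n hn
        · simp only [hn, if_false, not_lt.1 hn, if_true, zero_add]
          exact hlarge n (not_lt.1 hn)
    _ = _ := by
        rw [ENNReal.tsum_add, ENNReal.tsum_mul_left,
          tsum_eq_sum (s := Finset.range (h ^ 3)) (fun n hn => if_neg (by simpa using hn)),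
          Finset.sum_congr rfl fun n hn => if_pos (Finset.mem_range.1 hn)]
        simp [mul_assoc]

lemma exists_manyLoopsWeight_le :
    ∃ C : ℝ, 0 ≤ C ∧ ∀ h j K : ℕ, 1 ≤ K → K ≤ h → 10 ≤ h → K ^ 5 ≤ 32 * h ^ 2 →
      manyLoopsWeight h j K ≤ ENNReal.ofReal (C / h ^ 2) := by
  set M : ℕ := Nat.factorial 40 with hM
  set c : ℕ := 2 * Nat.factorial 9 * 800 ^ 9 with hc
  have hsum : Summable fun n : ℕ => 1 / (n : ℝ) ^ 2 := Real.summable_one_div_nat_pow.2 one_lt_two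
  set T : ℝ := ∑' n : ℕ, 1 / (n : ℝ) ^ 2 with hT
  have hT0 : 0 ≤ T := tsum_nonneg fun n => by positivity
  refine ⟨3 * M * 16 ^ 40 * 1024 ^ 8 + 4 * (c * T), by positivity, ?_⟩
  intro h j K hK hKh hh hKh5
  have hh1 : (1 : ℝ) ≤ h := by exact_mod_cast (by omega : 1 ≤ h)
  have hh0 : (0 : ℝ) < h := by linarith
  have hK0 : (0 : ℝ) < K := by exact_mod_cast hK
  have hK5 : (K : ℝ) ^ 5 ≤ 32 * h ^ 2 := by exact_mod_cast hKh5
  refine (manyLoopsWeight_le_add hK hKh hh).trans ?_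
  rw [add_div, ENNReal.ofReal_add (by positivity) (by positivity)]
  refine add_le_add ?_ ?_
  · rw [← ENNReal.ofReal_natCast, ← ENNReal.ofReal_mul (by positivity)]
    refine ENNReal.ofReal_le_ofReal ?_
    -- Since `K ^ 2` is of order at most h^(4/5), the exponent is at least of order h^(1/5); its
    -- 40th power gives `h ^ 8`, enough to beat the `h ^ 6` of the union bound.
    have e1 : Real.exp (-(h / (16 * K ^ 2))) ≤ M * 16 ^ 40 * 1024 ^ 8 / h ^ 8 := by
      refine (exp_neg_le_factorial_div 40 (by positivity)).trans ?_
      have e : ((K : ℝ) ^ 2) ^ 40 / (h : ℝ) ^ 40 ≤ 1024 ^ 8 / (h : ℝ) ^ 8 := by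
        rw [div_le_div_iff₀ (by positivity) (by positivity)]
        calc ((K : ℝ) ^ 2) ^ 40 * (h : ℝ) ^ 8 = ((K : ℝ) ^ 5) ^ 16 * (h : ℝ) ^ 8 := by ring
          _ ≤ (32 * (h : ℝ) ^ 2) ^ 16 * (h : ℝ) ^ 8 := by gcongr
          _ = 1024 ^ 8 * (h : ℝ) ^ 40 := by ring
      rw [← hM, div_pow, div_div_eq_mul_div, mul_pow]
      calc (M : ℝ) * (16 ^ 40 * ((K : ℝ) ^ 2) ^ 40) / (h : ℝ) ^ 40 =
            M * 16 ^ 40 * (((K : ℝ) ^ 2) ^ 40 / (h : ℝ) ^ 40) := by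
            rw [← mul_assoc, mul_div_assoc]
        _ ≤ M * 16 ^ 40 * (1024 ^ 8 / (h : ℝ) ^ 8) := by gcongr
        _ = M * 16 ^ 40 * 1024 ^ 8 / (h : ℝ) ^ 8 := by rw [mul_div_assoc]
    have e2 : ((h ^ 3 * (2 * h ^ 3 + 1) : ℕ) : ℝ) ≤ 3 * h ^ 6 := by
      push_cast
      have := one_le_pow₀ (n := 3) hh1
      nlinarith
    calc _ ≤ (3 * (h : ℝ) ^ 6) * (M * 16 ^ 40 * 1024 ^ 8 / h ^ 8) := by gcongr
      _ = _ := by generalize (M : ℝ) = M'; field_simp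
  · have e : ∀ n : ℕ, (if h ^ 3 ≤ n then
        ENNReal.ofReal (2 * Real.exp (-(n / (800 * h ^ 2)))) else 0) ≤
        ENNReal.ofReal (c / h ^ 2 * (1 / (n : ℝ) ^ 2)) := by
      intro n
      split_ifs with hn
      · refine ENNReal.ofReal_le_ofReal ?_
        have hn' : (h : ℝ) ^ 3 ≤ n := by exact_mod_cast hn
        have hn0 : (0 : ℝ) < n := lt_of_lt_of_le (by positivity) hn'
        -- The 9th power leaves `n ^ 2` for summation over `n`, while `n ^ 7 ≥ h ^ 21` absorbs the
        -- powers of `h`.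
        have e1 := exp_neg_le_factorial_div 9 (x := (n : ℝ) / (800 * h ^ 2)) (by positivity)
        have e3 : ((h : ℝ) ^ 2) ^ 9 / n ^ 9 ≤ 1 / h ^ 2 * (1 / n ^ 2) := by
          rw [one_div_mul_one_div, div_le_div_iff₀ (by positivity) (by positivity)]
          calc ((h : ℝ) ^ 2) ^ 9 * ((h : ℝ) ^ 2 * (n : ℝ) ^ 2) = (h : ℝ) ^ 20 * (n : ℝ) ^ 2 := by ring
            _ ≤ (h : ℝ) ^ 21 * (n : ℝ) ^ 2 := by gcongr; norm_num
            _ = ((h : ℝ) ^ 3) ^ 7 * (n : ℝ) ^ 2 := by ring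
            _ ≤ (n : ℝ) ^ 7 * (n : ℝ) ^ 2 := by gcongr
            _ = 1 * (n : ℝ) ^ 9 := by ring
        calc _ ≤ 2 * ((Nat.factorial 9 : ℝ) / (n / (800 * h ^ 2)) ^ 9) := by gcongr
          _ = c * (((h : ℝ) ^ 2) ^ 9 / n ^ 9) := by
              rw [hc, div_pow, div_div_eq_mul_div, mul_pow]; push_cast; ring
          _ ≤ c * (1 / h ^ 2 * (1 / n ^ 2)) := by gcongr
          _ = _ := by ring
      · exact zero_le
    calc _ ≤ 4 * ∑' n : ℕ, ENNReal.ofReal (c / h ^ 2 * (1 / (n : ℝ) ^ 2)) :=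
          mul_le_mul' le_rfl (ENNReal.tsum_le_tsum e)
      _ = _ := by
          rw [← ENNReal.ofReal_tsum_of_nonneg (fun n => by positivity) (hsum.mul_left _),
            tsum_mul_left, ← hT, show (4 : ℝ≥0∞) = ENNReal.ofReal 4 by norm_num,
            ← ENNReal.ofReal_mul (by norm_num)]
          congr 1
          ring

/-! ### Choice of the window and summation over heights -/

/-- The width of the window of heights into which tied sites are raised. -/
noncomputable def window (h : ℕ) : ℕ := ⌈(h : ℝ) ^ (2 / 5 : ℝ)⌉₊

lemma sq_le_window_pow (h : ℕ) : h ^ 2 ≤ window h ^ 5 := by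
  have h1 : (h : ℝ) ^ (2 / 5 : ℝ) ≤ window h := Nat.le_ceil _
  have h2 : (h : ℝ) ^ 2 ≤ (window h : ℝ) ^ 5 :=
    calc (h : ℝ) ^ 2 = ((h : ℝ) ^ (2 / 5 : ℝ)) ^ 5 := by
          rw [← Real.rpow_natCast, ← Real.rpow_natCast, ← Real.rpow_mul (by positivity)]
          norm_num
      _ ≤ _ := by gcongr
  exact_mod_cast h2

lemma window_pow_le {h : ℕ} (hh : 1 ≤ h) : window h ^ 5 ≤ 32 * h ^ 2 := by
  have h1 : (1 : ℝ) ≤ (h : ℝ) ^ (2 / 5 : ℝ) :=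
    Real.one_le_rpow (by exact_mod_cast hh) (by norm_num)
  have h3 : (window h : ℝ) ≤ 2 * (h : ℝ) ^ (2 / 5 : ℝ) := by
    have := (Nat.ceil_lt_add_one (a := (h : ℝ) ^ (2 / 5 : ℝ)) (by positivity)).le
    rw [window]
    linarith
  have h2 : (window h : ℝ) ^ 5 ≤ 32 * (h : ℝ) ^ 2 :=
    calc (window h : ℝ) ^ 5 ≤ (2 * (h : ℝ) ^ (2 / 5 : ℝ)) ^ 5 := by gcongr
      _ = 32 * ((h : ℝ) ^ (2 / 5 : ℝ)) ^ 5 := by ring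
      _ = _ := by
          rw [← Real.rpow_natCast ((h : ℝ) ^ (2 / 5 : ℝ)), ← Real.rpow_natCast,
            ← Real.rpow_mul (by positivity)]
          norm_num
  exact_mod_cast h2

lemma rpow_le_window_pow_three (h : ℕ) : (h : ℝ) ^ (6 / 5 : ℝ) ≤ (window h : ℝ) ^ 3 := by
  have h1 : (h : ℝ) ^ (2 / 5 : ℝ) ≤ window h := Nat.le_ceil _
  calc (h : ℝ) ^ (6 / 5 : ℝ) = ((h : ℝ) ^ (2 / 5 : ℝ)) ^ 3 := by
        rw [← Real.rpow_natCast, ← Real.rpow_mul (by positivity)]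
        norm_num
    _ ≤ _ := by gcongr

lemma window_sq_le {h : ℕ} (hh : 9 ^ 5 * 1024 ≤ h) : 9 * window h ^ 2 ≤ h := by
  have h1 := window_pow_le (by omega : 1 ≤ h)
  refine le_of_not_gt fun hlt => absurd (pow_lt_pow_left₀ hlt (Nat.zero_le _) (n := 5) (by norm_num))
    (not_lt.2 ?_)
  calc (9 * window h ^ 2) ^ 5 = 9 ^ 5 * (window h ^ 5) ^ 2 := by ring
    _ ≤ 9 ^ 5 * (32 * h ^ 2) ^ 2 := by gcongr
    _ = 9 ^ 5 * 1024 * h ^ 4 := by ring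
    _ ≤ h * h ^ 4 := by gcongr
    _ = h ^ 5 := by ring

open Classical in
lemma tsum_avg_tieLevel_zero_le {h K : ℕ} (hK : 1 ≤ K) (hh : 3 * K ^ 2 + 4 * K + 2 ≤ h)
    {B : ℝ} (hB : 0 ≤ B) (hW : ∀ j, manyLoopsWeight h j K ≤ ENNReal.ofReal B) :
    ∑' n, avg n (fun l => if TieLevel h 0 K l then 1 else 0) ≤
      ENNReal.ofReal (190 * B + 4374 / K ^ 3) := by
  have h0 := mul_tsum_avg_tieLevel_le hK (j := 0) (by norm_num) hh
  have h1 := mul_tsum_avg_tieLevel_le hK (j := 1) (by norm_num) hh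
  have h2 := mul_tsum_avg_tieLevel_le hK (j := 2) (by norm_num) hh
  have w : ∀ j, ∃ w : ℝ, 0 ≤ w ∧ w ≤ 1 ∧ ENNReal.ofReal w =
      ∑' n, avg n (fun l => if TieLevel h j K l then 1 else 0) := fun j => by
    have hle := tsum_avg_tieLevel_le_one h j K
    have hne := ne_top_of_le_ne_top ENNReal.one_ne_top hle
    exact ⟨_, ENNReal.toReal_nonneg, ENNReal.toReal_le_of_le_ofReal zero_le_one (by simpa using hle),
      ENNReal.ofReal_toReal hne⟩
  obtain ⟨w0, p0, -, e0⟩ := w 0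
  obtain ⟨w1, p1, -, e1⟩ := w 1
  obtain ⟨w2, p2, -, e2⟩ := w 2
  obtain ⟨w3, p3, q3, e3⟩ := w 3
  norm_num only [← e0, ← e1, ← e2, ← e3] at h0 h1 h2
  have conv : ∀ (j : ℕ) (c u v : ℝ), 0 ≤ c → 0 ≤ u → 0 ≤ v →
      K * ENNReal.ofReal u ≤ K * manyLoopsWeight h j K + ENNReal.ofReal c * ENNReal.ofReal v →
      K * u ≤ K * B + c * v := by
    intro j c u v hc hu hv hle
    have h' : K * ENNReal.ofReal u ≤
        K * ENNReal.ofReal B + ENNReal.ofReal c * ENNReal.ofReal v :=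
      hle.trans (by gcongr; exact hW j)
    rw [← ENNReal.ofReal_natCast, ← ENNReal.ofReal_mul (by positivity),
      ← ENNReal.ofReal_mul (by positivity), ← ENNReal.ofReal_mul (by positivity),
      ← ENNReal.ofReal_add (by positivity) (by positivity)] at h'
    exact (ENNReal.ofReal_le_ofReal_iff (by positivity)).1 h'
  have r0 := conv 0 9 w0 w1 (by norm_num) p0 p1 (by simpa using h0)
  have r1 := conv 1 18 w1 w2 (by norm_num) p1 p2 (by simpa using h1)
  have r2 := conv 2 27 w2 w3 (by norm_num) p2 p3 (by simpa using h2)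
  have hKr : (1 : ℝ) ≤ K := by exact_mod_cast hK
  rw [← e0]
  refine ENNReal.ofReal_le_ofReal ?_
  have hK3 : (0 : ℝ) < K ^ 3 := by positivity
  -- Chaining the three inequalities gives `9 * 18 * 27 = 4374`, and the errors add up to at most
  -- `(1 + 9 + 162) * B * K ^ 3`.
  have s : w0 * K ^ 3 ≤ 190 * B * K ^ 3 + 4374 := by
    have a0 := mul_le_mul_of_nonneg_right r0 (sq_nonneg (K : ℝ))
    have a1 := mul_le_mul_of_nonneg_right r1 (by positivity : (0 : ℝ) ≤ K)
    have b1 : B * K ^ 2 ≤ B * K ^ 3 := by gcongr; norm_num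
    have b2 : B * K ≤ B * K ^ 3 := by
      gcongr
      exact le_self_pow₀ hKr (by norm_num)
    nlinarith
  have : w0 ≤ (190 * B * K ^ 3 + 4374) / K ^ 3 := by rwa [le_div_iff₀ hK3]
  rwa [add_div, mul_div_cancel_right₀ _ hK3.ne'] at this

open Classical in
lemma tsum_tsum_avg_tieLevel_lt_top :
    ∑' h, ∑' n, avg n (fun l => if TieLevel h 0 (window h) l then 1 else 0) < ∞ := by
  obtain ⟨C, hC, hW⟩ := exists_manyLoopsWeight_le
  set g : ℕ → ℝ := fun h => 190 * (C * (1 / (h : ℝ) ^ 2)) + 4374 * (1 / (h : ℝ) ^ (6 / 5 : ℝ))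
    with hg
  have hgs : Summable g :=
    (((Real.summable_one_div_nat_pow.2 one_lt_two).mul_left C).mul_left 190).add
      ((Real.summable_one_div_nat_rpow.2 (by norm_num)).mul_left 4374)
  have hg0 : ∀ h, 0 ≤ g h := fun h => by positivity
  have hle : ∀ h, ∑' n, avg n (fun l => if TieLevel h 0 (window h) l then 1 else 0) ≤
      (if h < 9 ^ 5 * 1024 then 1 else 0) + ENNReal.ofReal (g h) := by
    intro h
    split_ifs with hh
    -- The finitely many small heights contribute at most 1 each.
    · exact le_add_right (tsum_avg_tieLevel_le_one h 0 _)
    · rw [not_lt] at hh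
      have hw0 := sq_le_window_pow h
      have hw1 : 1 ≤ window h := Nat.one_le_iff_ne_zero.2 fun h0 => by
        rw [h0] at hw0
        have : 0 < h ^ 2 := by positivity
        simp at hw0
        omega
      have hw2 := window_sq_le hh
      rw [zero_add]
      refine (tsum_avg_tieLevel_zero_le hw1 (by nlinarith) (B := C / h ^ 2) (by positivity)
        fun j => hW h j _ hw1 (by nlinarith) (by omega) (window_pow_le (by omega))).trans ?_
      refine ENNReal.ofReal_le_ofReal ?_
      have hp : (0 : ℝ) < (h : ℝ) ^ (6 / 5 : ℝ) :=
        Real.rpow_pos_of_pos (by exact_mod_cast (by omega : 0 < h)) _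
      simp only [hg]
      rw [mul_one_div, mul_one_div]
      gcongr
      exact rpow_le_window_pow_three h
  refine (ENNReal.tsum_le_tsum hle).trans_lt ?_
  rw [ENNReal.tsum_add, ENNReal.add_lt_top]
  refine ⟨?_, ?_⟩
  · rw [tsum_eq_sum (s := Finset.range (9 ^ 5 * 1024)) fun h hh => if_neg (by simpa using hh)]
    exact (ENNReal.sum_lt_top.2 fun h _ => by split_ifs <;> simp)
  · rw [← ENNReal.ofReal_tsum_of_nonneg hg0 hgs]
    exact ENNReal.ofReal_lt_top

/-! ### Transfer to the random walk -/

lemma avg_eq_sum (n : ℕ) (G : List Bool → ℝ≥0∞) :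
    avg n G = ∑ v : Fin n → Bool, G (List.ofFn v) * 2⁻¹ ^ n := by
  induction n generalizing G with
  | zero => simp [avg]
  | succ n ih =>
    have hcons : ∀ (c : Bool) (v : Fin n → Bool),
        List.ofFn (Fin.consEquiv (fun _ => Bool) (c, v)) = c :: List.ofFn v := fun c v => by
      simp [Fin.consEquiv, List.ofFn_succ]
    rw [← (Fin.consEquiv (fun _ => Bool)).sum_comp, Fintype.sum_prod_type, Fintype.sum_bool, avg,
      ih, ih]
    simp only [hcons, pow_succ, ← mul_assoc, ← Finset.sum_mul]
    ring

/-- The increments of a walk, as bits. -/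
def bits {Ω : Type*} (S : ℕ → Ω → ℤ) (n : ℕ) (ω : Ω) : Fin n → Bool :=
  fun i => decide (S (i + 1) ω - S i ω = 1)

lemma ofFn_bits_succ {Ω : Type*} (S : ℕ → Ω → ℤ) (n : ℕ) (ω : Ω) :
    List.ofFn (bits S (n + 1) ω) =
      List.ofFn (bits S n ω) ++ [decide (S (n + 1) ω - S n ω = 1)] := by
  rw [List.ofFn_succ', List.concat_eq_append]
  rfl

/-- The trajectory starts at `0` and has increments `1` and `-1` only. -/
def IsSimplePath (s : ℕ → ℤ) : Prop :=
  s 0 = 0 ∧ ∀ n, s (n + 1) - s n = 1 ∨ s (n + 1) - s n = -1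

section Law

variable {Ω : Type*} [MeasurableSpace Ω] {μ : Measure Ω} {S : ℕ → Ω → ℤ}

lemma measurable_bits (hS : IsSimpleSymmetricRandomWalk μ S) (n : ℕ) : Measurable (bits S n) := by
  refine measurable_pi_lambda _ fun i => ?_
  exact (measurable_of_countable fun z : ℤ => decide (z = 1)).comp
    ((hS.measurable _).sub (hS.measurable _))

lemma measure_bits [IsProbabilityMeasure μ] (hS : IsSimpleSymmetricRandomWalk μ S) (n : ℕ) (v : Fin n → Bool) :
    μ (bits S n ⁻¹' {v}) = 2⁻¹ ^ n := by
  have hind := hS.indep.precomp (Fin.val_injective (n := n))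
  have key := hind.measure_inter_preimage_eq_mul Finset.univ
    (sets := fun i => {z : ℤ | decide (z = 1) = v i}) (fun i _ => MeasurableSet.of_discrete)
  have hset : bits S n ⁻¹' {v} = ⋂ i ∈ (Finset.univ : Finset (Fin n)),
      (fun ω => S (i + 1) ω - S i ω) ⁻¹' {z : ℤ | decide (z = 1) = v i} := by
    ext ω
    simp [bits, funext_iff]
  rw [hset]
  refine key.trans ?_
  rw [Finset.prod_eq_pow_card (b := 2⁻¹)]
  · simp
  · intro i _
    have hup := hS.up i
    rw [one_div] at hup
    cases hv : v i with
    | true =>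
      rw [← hup]
      congr 1
      ext ω
      simp
    | false =>
      -- A bit is `false` whenever the increment is not 1, so its probability is that of a
      -- complement.
      have hm : MeasurableSet {ω | S (i + 1) ω - S i ω = 1} :=
        ((hS.measurable _).sub (hS.measurable _)) (measurableSet_singleton 1)
      have hc := prob_compl_eq_one_sub (μ := μ) hm
      rw [hup, ENNReal.one_sub_inv_two] at hc
      rw [← hc]
      congr 1
      ext ω
      simp

lemma lintegral_bits [IsProbabilityMeasure μ] (hS : IsSimpleSymmetricRandomWalk μ S) (n : ℕ) (G : List Bool → ℝ≥0∞) :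
    ∫⁻ ω, G (List.ofFn (bits S n ω)) ∂μ = avg n G := by
  rw [← lintegral_map (f := fun v : Fin n → Bool => G (List.ofFn v)) (measurable_of_countable _)
    (measurable_bits hS n), lintegral_fintype, avg_eq_sum]
  refine Finset.sum_congr rfl fun v _ => ?_
  rw [Measure.map_apply (measurable_bits hS n) (measurableSet_singleton v), measure_bits hS]

lemma ae_isSimplePath [IsProbabilityMeasure μ] (hS : IsSimpleSymmetricRandomWalk μ S) :
    ∀ᵐ ω ∂μ, IsSimplePath (fun n => S n ω) := by
  refine hS.start.and (ae_all_iff.2 fun n => ?_)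
  have hm : ∀ z : ℤ, MeasurableSet {ω | S (n + 1) ω - S n ω = z} := fun z =>
    ((hS.measurable _).sub (hS.measurable _)) (measurableSet_singleton z)
  have hu : μ ({ω | S (n + 1) ω - S n ω = 1} ∪ {ω | S (n + 1) ω - S n ω = -1}) = 1 := by
    rw [measure_union _ (hm _), hS.up, hS.down, ENNReal.add_halves]
    rw [Set.disjoint_left]
    intro ω h1 h2
    have h1' : S (n + 1) ω - S n ω = 1 := h1
    have h2' : S (n + 1) ω - S n ω = -1 := h2
    omega
  exact (prob_compl_eq_zero_iff ((hm 1).union (hm (-1)))).2 hu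

end Law

section Trajectory

variable {Ω : Type*} {S : ℕ → Ω → ℤ}

lemma disp_bits {ω : Ω} (hω : IsSimplePath (fun n => S n ω)) (n : ℕ) :
    disp (List.ofFn (bits S n ω)) = S n ω := by
  induction n with
  | zero => simpa using hω.1.symm
  | succ n ih =>
    rw [ofFn_bits_succ, disp_append, ih]
    obtain h | h : S (n + 1) ω - S n ω = 1 ∨ S (n + 1) ω - S n ω = -1 := hω.2 n
    · simp [h]; omega
    · simp [h]; omega

lemma downs_bits {ω : Ω} (hω : IsSimplePath (fun n => S n ω)) (y : ℤ) (n : ℕ) :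
    downs y 0 (List.ofFn (bits S n ω)) = downcrossings (fun n => S n ω) y n := by
  induction n with
  | zero => simp [downs, downcrossings]
  | succ n ih =>
    have hiff : (S n ω = y + 1 ∧ decide (S (n + 1) ω - S n ω = 1) = false) ↔
        (S (n + 1) ω = y ∧ S n ω = y + 1) := by
      obtain h | h : S (n + 1) ω - S n ω = 1 ∨ S (n + 1) ω - S n ω = -1 := hω.2 n
      · simp only [h, decide_true, Bool.true_eq_false, and_false, false_iff]; omega
      · simp only [h]; simp; omega
    rw [ofFn_bits_succ, downs_append, ih, zero_add, disp_bits hω]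
    simp only [downs, hiff, add_zero]
    rw [downcrossings, downcrossings, ← Finset.insert_Ioc_right_eq_Ioc_add_one (Nat.zero_le n),
      Finset.filter_insert]
    simp only [Nat.add_sub_cancel]
    split_ifs with h
    · rw [Finset.card_insert_of_notMem (by simp)]
    · simp

lemma tieLevel_bits {ω : Ω} (hω : IsSimplePath (fun n => S n ω)) {n : ℕ} (K : ℕ → ℕ) (hn : 1 ≤ n)
    (hmem : S n ω ∈ favoriteDowncrossingSites (fun n => S n ω) n) (hdown : S n ω = S (n - 1) ω - 1)
    (hcard : (favoriteDowncrossingSites (fun n => S n ω) n).encard = 4) :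
    ∃ h, TieLevel h 0 (K h) (List.ofFn (bits S n ω)) := by
  -- The level is the current maximum: the sites at height at least `h` are exactly the favorites,
  -- none exceeds it, and the cap holds whatever `K` is.
  refine ⟨downcrossings (fun n => S n ω) (S n ω) n, ?_, ?_, ?_, ?_, ?_⟩
  · obtain ⟨n, rfl⟩ : ∃ m, n = m + 1 := ⟨n - 1, by omega⟩
    rw [ofFn_bits_succ, List.getLast?_concat]
    rw [Nat.add_sub_cancel] at hdown
    simp [hdown]
  · rw [disp_bits hω, downs_bits hω]
  · rw [← hcard]
    congr 1
    ext y
    simp only [downs_bits hω]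
    exact ⟨fun hy z => (hmem z).trans hy, fun hy => hy _⟩
  · rw [show {y | downcrossings (fun n => S n ω) (S n ω) n <
        downs y 0 (List.ofFn (bits S n ω))} = ∅ by
      ext y
      simpa [downs_bits hω] using hmem y]
    simp
  · intro y
    rw [downs_bits hω]
    exact (hmem y).trans (Nat.le_add_right _ _)

open Classical in
lemma favoriteDowncrossingCount_le {ω : Ω} (hω : IsSimplePath (fun n => S n ω)) (K : ℕ → ℕ) :
    (favoriteDowncrossingCount (fun n => S n ω) 4 : ℝ≥0∞) ≤
      ∑' n, ∑' h, if TieLevel h 0 (K h) (List.ofFn (bits S n ω)) then 1 else 0 := by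
  rw [favoriteDowncrossingCount, ← ENNReal.tsum_set_one, tsum_subtype _ (fun _ => (1 : ℝ≥0∞))]
  refine ENNReal.tsum_le_tsum fun n => ?_
  rw [Set.indicator_apply]
  split_ifs with hn
  · obtain ⟨h1, h2, h3, h4⟩ := hn
    obtain ⟨h, hh⟩ := tieLevel_bits hω K h1 h2 h3 h4
    exact le_trans (by rw [if_pos hh]) (ENNReal.le_tsum h)
  · exact zero_le

end Trajectory

end SignPath

open SignPath in
theorem theorem1p3 {Ω : Type*} [MeasurableSpace Ω] (μ : Measure Ω) [IsProbabilityMeasure μ]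
    (S : ℕ → Ω → ℤ) (hS : IsSimpleSymmetricRandomWalk μ S) :
    ∫⁻ ω, (favoriteDowncrossingCount (fun n => S n ω) 4 : ℝ≥0∞) ∂μ < ∞ := by
  classical
  calc ∫⁻ ω, (favoriteDowncrossingCount (fun n => S n ω) 4 : ℝ≥0∞) ∂μ
      ≤ ∫⁻ ω, ∑' n, ∑' h,
          (if TieLevel h 0 (window h) (List.ofFn (bits S n ω)) then 1 else 0) ∂μ :=
        lintegral_mono_ae ((ae_isSimplePath hS).mono fun ω hω =>
          favoriteDowncrossingCount_le hω window)
    _ = ∑' n, avg n (fun l => ∑' h, if TieLevel h 0 (window h) l then 1 else 0) := by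
        have hm : ∀ n, AEMeasurable (fun ω => ∑' h, if TieLevel h 0 (window h)
            (List.ofFn (bits S n ω)) then (1 : ℝ≥0∞) else 0) μ := fun n =>
          ((measurable_of_countable fun v : Fin n → Bool =>
            ∑' h, if TieLevel h 0 (window h) (List.ofFn v) then (1 : ℝ≥0∞) else 0).comp
              (measurable_bits hS n)).aemeasurable
        rw [lintegral_tsum hm]
        exact tsum_congr fun n => lintegral_bits hS n
          (fun l => ∑' h, if TieLevel h 0 (window h) l then 1 else 0)
    _ = ∑' h, ∑' n, avg n (fun l => if TieLevel h 0 (window h) l then 1 else 0) := by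
        simp_rw [avg_tsum]
        exact ENNReal.tsum_comm
    _ < ∞ := tsum_tsum_avg_tieLevel_lt_top
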